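/- Let $(X,Y)$, with $X$ taking values in $\mathbb{R}^{n}$ and $Y$ in $\mathbb{R}^{k}$, be jointly Gaussian with mean $(\mu_x,\mu_y)$ and covariance matrix $\Sigma=\begin{pmatrix}\Sigma_{xx}&\Sigma_{xy}\\ \Sigma_{yx}&\Sigma_{yy}\end{pmatrix}$. Assume that $\Sigma_{xx}$ is invertible and that this law has a probability density $f$ on $\mathbb{R}^n\times\mathbb{R}^k$ with respect to Lebesgue measure. Let $g$ be a probability density on $\mathbb{R}^{n}$ with finite first moments along each component, write $E_g[X]=\int x\,g(x)\,dx$, and let $a\in\mathbb{R}^k$. Call a probability density $p$ on $\mathbb{R}^n\times\mathbb{R}^k$ feasible if $p(x,y)\,dx\,dy$ is absolutely continuous with respect to $f(x,y)\,dx\,dy$, $\int p(x,y)\,dy=g(x)$ for all $x$, and $y\,p(x,y)$ is integrable with $\int\!\!\int y\,p(x,y)\,dy\,dx=a$. Let $D(p\,\|\,f)=\int\!\!\int \log\frac{p(x,y)}{f(x,y)}\;p(x,y)\,dx\,dy\in[0,\infty]$ be the $I$-divergence, with value $+\infty$ if $\log(p/f)$ is not integrable with respect to $p(x,y)\,dx\,dy$.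 Then there is a function $\tilde f(y\mid x)$ such that, for every $x$, $\tilde f(\cdot\mid x)$ is a probability density of $$\mathcal{N}_k\left(a+\Sigma_{yx}\Sigma_{xx}^{-1}(x-E_g[X]),\ \Sigma_{yy}-\Sigma_{yx}\Sigma_{xx}^{-1}\Sigma_{xy}\right),$$ and such that $\tilde f(x,y)=g(x)\,\tilde f(y\mid x)$ is feasible and minimizes $D(\cdot\,\|\,f)$ over all feasible densities. If moreover $D(\tilde f\,\|\,f)<\infty$, then every minimizer is equal to $\tilde f$ Lebesgue-almost everywhere. -/

import Mathlib

open MeasureTheory ProbabilityTheory InformationTheory Matrix WithLp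
open scoped ENNReal

noncomputable section

/-- `p` is a (nonnegative, Borel measurable) probability density function with respect to the
reference measure `volume` (Lebesgue measure in all uses below). -/
structure IsProbDensity {α : Type*} [MeasureSpace α] (p : α → ℝ) : Prop where
  measurable : Measurable p
  nonneg : ∀ z, 0 ≤ p z
  lintegral_eq_one : ∫⁻ z, ENNReal.ofReal (p z) = 1

/-- The measure `p(z) dz` with density `p`. -/
def densityMeasure {α : Type*} [MeasureSpace α] (p : α → ℝ) : Measure α :=
  volume.withDensity fun z => ENNReal.ofReal (p z)

/-- `p` is a probability density function of the law `μ`. -/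
structure IsDensityOf {α : Type*} [MeasureSpace α] (p : α → ℝ) (μ : Measure α) : Prop where
  isProbDensity : IsProbDensity p
  densityMeasure_eq : densityMeasure p = μ

/-- The law of `(X, Y)`, with `X` in `ℝⁿ` and `Y` in `ℝᵏ`, when the concatenated vector is
Gaussian with mean `(μx, μy)` and covariance matrix with blocks `Sxx, Sxy, Syx, Syy`. -/
def gaussianPairLaw {n k : ℕ} (μx : EuclideanSpace ℝ (Fin n)) (μy : EuclideanSpace ℝ (Fin k))
    (Sxx : Matrix (Fin n) (Fin n) ℝ) (Sxy : Matrix (Fin n) (Fin k) ℝ)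
    (Syx : Matrix (Fin k) (Fin n) ℝ) (Syy : Matrix (Fin k) (Fin k) ℝ) :
    Measure (EuclideanSpace ℝ (Fin n) × EuclideanSpace ℝ (Fin k)) :=
  (multivariateGaussian (toLp 2 (Sum.elim (ofLp μx) (ofLp μy)))
      (Matrix.fromBlocks Sxx Sxy Syx Syy)).map
    fun z => (toLp 2 fun i => z (Sum.inl i), toLp 2 fun j => z (Sum.inr j))

/-- The `I`-divergence (relative entropy) `∫ log (p / f) p` of the density `p` with respect to the
density `f`, equal to `∞` if `p` is not absolutely continuous with respect to `f` or if
`log (p / f)` is not integrable with respect to `p`. -/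
def iDivergence {α : Type*} [MeasureSpace α] (p f : α → ℝ) : ℝ≥0∞ :=
  klDiv (densityMeasure p) (densityMeasure f)

/-- The constraints on the posterior density `p` of `(X, Y)`: it is a probability density that is
absolutely continuous with respect to the prior density `f`, its `X`-marginal density is `g`,
and the mean of `Y` under `p` exists and equals `a`. -/
structure IsFeasible {n k : ℕ} (f : EuclideanSpace ℝ (Fin n) × EuclideanSpace ℝ (Fin k) → ℝ)
    (g : EuclideanSpace ℝ (Fin n) → ℝ) (a : EuclideanSpace ℝ (Fin k))
    (p : EuclideanSpace ℝ (Fin n) × EuclideanSpace ℝ (Fin k) → ℝ) : Prop where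
  isProbDensity : IsProbDensity p
  absolutelyContinuous : densityMeasure p ≪ densityMeasure f
  marginal : ∀ x, ∫⁻ y, ENNReal.ofReal (p (x, y)) = ENNReal.ofReal (g x)
  integrable : Integrable fun z => p z • z.2
  mean : ∫ z, p z • z.2 = a

/-- `p` is an optimal solution of the problem of minimizing the `I`-divergence with respect to `f`
over all feasible densities. -/
structure IsOptimal {n k : ℕ} (f : EuclideanSpace ℝ (Fin n) × EuclideanSpace ℝ (Fin k) → ℝ)
    (g : EuclideanSpace ℝ (Fin n) → ℝ) (a : EuclideanSpace ℝ (Fin k))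
    (p : EuclideanSpace ℝ (Fin n) × EuclideanSpace ℝ (Fin k) → ℝ) : Prop where
  isFeasible : IsFeasible f g a p
  le : ∀ p', IsFeasible f g a p' → iDivergence p f ≤ iDivergence p' f

end

/-! ### Density measures -/

/-! Put `B = Σyx Σxx⁻¹` and let `C` be the Schur complement of `Σxx`. Regressing `Y` on `X` makes
the prior a shear of the product of the law of `X` and `N(0, C)` (`gaussianPairLaw_eq_map_shear`).
As the prior has a density, `C` is nondegenerate, so `f = f_X(x) φ(y - β - Bx)` almost everywhere,
with `φ` the positive density of `N(0, C)`. The candidate is `g(x) φ(y - α - Bx)`, where `α = a - B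
E_g[X]` gives `Y` the mean `a`.

The log-ratio of the candidate to `f` is a function of `x` alone plus `log φ(w - α) - log φ(w - β)`
at `w = y - Bx`. In the second term the quadratic parts cancel, so it is affine in `(x, y)` and its
integral depends only on `E_g[X]` and `a`; the first integrates through the marginal `g`. All
feasible `p` therefore give the log-ratio the same integral, which yields the Pythagorean identity
`D(p‖f) = D(p‖f̃) + D(f̃‖f)` whenever `D(p‖f)` is finite (`klDiv_eq_add_of_llr_eq`,
`IsFeasible.klDiv_eq_add`). Optimality follows at once, and a second minimizer has `D(p‖f̃) = 0`.
The analytic difficulty is that the two terms of the log-ratio are not known in advance to be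
integrable. -/

theorem MeasurableEquiv.map_withDensity {α β : Type*} [MeasurableSpace α] [MeasurableSpace β]
    (e : α ≃ᵐ β) (μ : Measure α) (h : α → ℝ≥0∞) :
    (μ.withDensity h).map e = (μ.map e).withDensity (h ∘ e.symm) := by
  ext s hs
  rw [e.map_apply, withDensity_apply _ (e.measurable hs), withDensity_apply _ hs,
    e.restrict_map, lintegral_map_equiv]
  simp

theorem IsProbDensity.isProbabilityMeasure {α : Type*} [MeasureSpace α] {p : α → ℝ}
    (hp : IsProbDensity p) : IsProbabilityMeasure (densityMeasure p) :=
  ⟨by rw [densityMeasure, withDensity_apply _ MeasurableSet.univ, setLIntegral_univ,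
    hp.lintegral_eq_one]⟩

theorem isDensityOf_of_densityMeasure_eq {α : Type*} [MeasureSpace α] {p : α → ℝ} {μ : Measure α}
    [IsProbabilityMeasure μ] (hm : Measurable p) (h0 : ∀ z, 0 ≤ p z) (h : densityMeasure p = μ) :
    IsDensityOf p μ where
  isProbDensity :=
    { measurable := hm
      nonneg := h0
      lintegral_eq_one := by
        have : μ Set.univ = 1 := measure_univ
        rwa [← h, densityMeasure, withDensity_apply _ MeasurableSet.univ, setLIntegral_univ]
          at this }
  densityMeasure_eq := h

theorem densityMeasure_eq_iff {α : Type*} [MeasureSpace α] {p q : α → ℝ}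
    (hp : IsProbDensity p) (hq : IsProbDensity q) :
    densityMeasure p = densityMeasure q ↔ p =ᵐ[volume] q := by
  rw [densityMeasure, densityMeasure, withDensity_eq_iff hp.measurable.ennreal_ofReal.aemeasurable
    hq.measurable.ennreal_ofReal.aemeasurable (by simp [hp.lintegral_eq_one])]
  refine ⟨fun h => ?_, fun h => h.fun_comp ENNReal.ofReal⟩
  filter_upwards [h] with x hx
  exact (ENNReal.ofReal_eq_ofReal_iff (hp.nonneg x) (hq.nonneg x)).1 hx

theorem integrable_densityMeasure_iff {α E : Type*} [MeasureSpace α] [NormedAddCommGroup E]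
    [NormedSpace ℝ E] {p : α → ℝ} (hp : IsProbDensity p) {h : α → E} :
    Integrable h (densityMeasure p) ↔ Integrable fun x => p x • h x := by
  rw [densityMeasure, integrable_withDensity_iff_integrable_smul'
    hp.measurable.ennreal_ofReal (by simp)]
  simp [ENNReal.toReal_ofReal (hp.nonneg _)]

theorem integral_densityMeasure {α E : Type*} [MeasureSpace α] [NormedAddCommGroup E]
    [NormedSpace ℝ E] {p : α → ℝ} (hp : IsProbDensity p) (h : α → E) :
    ∫ x, h x ∂densityMeasure p = ∫ x, p x • h x := by
  rw [densityMeasure, integral_withDensity_eq_integral_toReal_smul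
    hp.measurable.ennreal_ofReal (by simp)]
  simp [ENNReal.toReal_ofReal (hp.nonneg _)]

/-! ### Gaussian densities -/

section Gaussian

variable {E : Type*} [NormedAddCommGroup E] [InnerProductSpace ℝ E] [FiniteDimensional ℝ E]
  [MeasurableSpace E] [BorelSpace E]

/-- The standard Gaussian measure has a density proportional to `exp (-‖x‖² / 2)`. -/
theorem exists_stdGaussian_density : ∃ K : ℝ, 0 < K ∧
    stdGaussian E = (volume : Measure E).withDensity
      fun x => ENNReal.ofReal (K * Real.exp (-(1 / 2) * ‖x‖ ^ 2)) := by
  set d : ℝ := (Module.finrank ℝ E : ℝ)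
  have hpi : (0 : ℝ) < Real.pi / (1 / 2) := by positivity
  -- The Fourier transform of the unnormalized Gaussian, which also gives the constant `K`; the two
  -- measures are then compared through characteristic functions.
  have key (w : E) : ∫ v : E, Complex.exp (-(1 / 2 : ℂ) * ‖v‖ ^ 2 + Complex.I * inner ℝ w v) =
      ((Real.pi / (1 / 2)) ^ (d / 2) : ℝ) * Complex.exp (-‖w‖ ^ 2 / 2) := by
    rw [GaussianFourier.integral_cexp_neg_mul_sq_norm_add (by norm_num)]
    congr 1
    · rw [Complex.ofReal_cpow hpi.le]; simp [d]
    · congr 1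
      rw [Complex.I_sq]; ring
  refine ⟨((Real.pi / (1 / 2)) ^ (d / 2))⁻¹, by positivity, ?_⟩
  set K : ℝ := (Real.pi / (1 / 2)) ^ (d / 2)
  have hK : 0 < K := by positivity
  have hint : Integrable fun v : E => K⁻¹ * Real.exp (-(1 / 2) * ‖v‖ ^ 2) := by
    have h := GaussianFourier.integrable_cexp_neg_mul_sq_norm_add (V := E) (b := 1 / 2)
      (by norm_num) 0 0
    refine Integrable.const_mul (h.re.congr (ae_of_all _ fun v => ?_)) _
    simp only [zero_mul, add_zero]
    rw [show (-(1 / 2 : ℂ) * (‖v‖ : ℂ) ^ 2) = ((-(1 / 2) * ‖v‖ ^ 2 : ℝ) : ℂ) by push_cast; ring]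
    exact Complex.exp_ofReal_re _
  have : IsFiniteMeasure ((volume : Measure E).withDensity
      fun x => ENNReal.ofReal (K⁻¹ * Real.exp (-(1 / 2) * ‖x‖ ^ 2))) :=
    isFiniteMeasure_withDensity_ofReal hint.2
  refine Measure.ext_of_charFun ?_
  ext t
  rw [charFun_stdGaussian, charFun_apply,
    integral_withDensity_eq_integral_toReal_smul (by fun_prop) (by simp)]
  have h2 : ∀ v : E, (ENNReal.ofReal (K⁻¹ * Real.exp (-(1 / 2) * ‖v‖ ^ 2))).toReal •
      Complex.exp (inner ℝ v t * Complex.I) =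
      (K⁻¹ : ℂ) * Complex.exp (-(1 / 2 : ℂ) * ‖v‖ ^ 2 + Complex.I * inner ℝ t v) := by
    intro v
    rw [ENNReal.toReal_ofReal (by positivity), Complex.exp_add, real_inner_comm, Complex.real_smul]
    push_cast
    ring_nf
  simp_rw [h2]
  rw [integral_const_mul, key, ← mul_assoc]
  have : (K : ℂ) ≠ 0 := by exact_mod_cast hK.ne'
  rw [inv_mul_cancel₀ this, one_mul]

end Gaussian

section MultivariateGaussian

open scoped MatrixOrder

/-- A nondegenerate multivariate Gaussian has a positive continuous density `φ (y - m)`, whose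
logarithm changes by an affine function of `y` when the mean `m` is changed. -/
theorem exists_multivariateGaussian_density {ι : Type*} [Fintype ι] [DecidableEq ι]
    {S : Matrix ι ι ℝ} (hS : IsUnit (CFC.sqrt S)) :
    ∃ φ : EuclideanSpace ℝ ι → ℝ, Continuous φ ∧ (∀ y, 0 < φ y) ∧
      (∀ m, IsDensityOf (fun y => φ (y - m)) (multivariateGaussian m S)) ∧
      ∀ α β, ∃ (L : EuclideanSpace ℝ ι →L[ℝ] ℝ) (c : ℝ), ∀ u,
        Real.log (φ (u - α)) - Real.log (φ (u - β)) = L u + c := by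
  obtain ⟨K, hK, hstd⟩ := exists_stdGaussian_density (E := EuclideanSpace ℝ ι)
  obtain ⟨U, hU⟩ := hS.map (toEuclideanCLM (𝕜 := ℝ) (n := ι))
  set e : EuclideanSpace ℝ ι ≃L[ℝ] EuclideanSpace ℝ ι := ContinuousLinearEquiv.ofUnit U
  have he : ∀ x, e x = toEuclideanCLM (𝕜 := ℝ) (CFC.sqrt S) x := fun x => by rw [← hU]; rfl
  have hdet : LinearMap.det (e : EuclideanSpace ℝ ι →ₗ[ℝ] EuclideanSpace ℝ ι) ≠ 0 :=
    e.toLinearEquiv.isUnit_det'.ne_zero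
  set D : ℝ := |(LinearMap.det (e : EuclideanSpace ℝ ι →ₗ[ℝ] EuclideanSpace ℝ ι))⁻¹|
  have hD : 0 < D := abs_pos.2 (inv_ne_zero hdet)
  refine ⟨fun y => D * (K * Real.exp (-(1 / 2) * ‖e.symm y‖ ^ 2)), by fun_prop,
    fun y => by positivity, fun m => ?_, fun α β => ?_⟩
  · refine isDensityOf_of_densityMeasure_eq (by fun_prop) (fun z => by positivity) ?_
    set M : EuclideanSpace ℝ ι ≃ᵐ EuclideanSpace ℝ ι :=
      e.toHomeomorph.toMeasurableEquiv.trans (MeasurableEquiv.addLeft m)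
    have hM : (fun x => m + toEuclideanCLM (𝕜 := ℝ) (CFC.sqrt S) x) = M := by
      ext1 x; rw [← he]; rfl
    have hsymm : ∀ y, M.symm y = e.symm (y - m) := fun y => by
      change e.symm (-m + y) = _
      rw [neg_add_eq_sub]
    have hvol : (volume : Measure (EuclideanSpace ℝ ι)).map M = ENNReal.ofReal D • volume := by
      have : (M : EuclideanSpace ℝ ι → EuclideanSpace ℝ ι) = (fun x => m + x) ∘
        (e : EuclideanSpace ℝ ι →ₗ[ℝ] EuclideanSpace ℝ ι) := rfl
      rw [this, ← Measure.map_map (by fun_prop) (by fun_prop),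
        Measure.map_linearMap_addHaar_eq_smul_addHaar _ hdet, Measure.map_smul,
        (measurePreserving_add_left volume m).map_eq]
    rw [multivariateGaussian, hM, hstd, M.map_withDensity, hvol, withDensity_smul_measure,
      ← withDensity_smul _ (by fun_prop), densityMeasure]
    congr 1
    ext y
    simp only [Pi.smul_apply, Function.comp, hsymm, smul_eq_mul]
    rw [ENNReal.ofReal_mul hD.le]
  -- Expanding both squares `‖e.symm u - e.symm α‖²` and `‖e.symm u - e.symm β‖²`, the terms
  -- `‖e.symm u‖²` cancel; the cross terms give `L` and the remaining ones `c`.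
  · refine ⟨(innerSL ℝ (e.symm α - e.symm β)).comp (e.symm : _ →L[ℝ] _),
      (‖e.symm β‖ ^ 2 - ‖e.symm α‖ ^ 2) / 2, fun u => ?_⟩
    have hlog (y) : Real.log (D * (K * Real.exp (-(1 / 2) * ‖e.symm y‖ ^ 2))) =
        Real.log D + (Real.log K + -(1 / 2) * ‖e.symm y‖ ^ 2) := by
      rw [Real.log_mul hD.ne' (by positivity), Real.log_mul hK.ne' (by positivity), Real.log_exp]
    rw [hlog, hlog, map_sub, map_sub, norm_sub_sq_real, norm_sub_sq_real]
    simp [real_inner_comm]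
    ring

/-- If a multivariate Gaussian is absolutely continuous, its covariance is nondegenerate. -/
theorem isUnit_sqrt_of_multivariateGaussian_ac {ι : Type*} [Fintype ι] [DecidableEq ι]
    {S : Matrix ι ι ℝ} (h : multivariateGaussian 0 S ≪ volume) : IsUnit (CFC.sqrt S) := by
  set T := toEuclideanCLM (𝕜 := ℝ) (CFC.sqrt S)
  have hr : LinearMap.range (T : EuclideanSpace ℝ ι →ₗ[ℝ] EuclideanSpace ℝ ι) = ⊤ := by
    -- A proper range would be a Lebesgue-null subspace carrying the whole Gaussian law.
    by_contra hne
    have h0 := h (Measure.addHaar_submodule volume _ hne)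
    rw [multivariateGaussian, Measure.map_apply (by fun_prop)
      (Submodule.closed_of_finiteDimensional _).measurableSet] at h0
    have : (fun x => 0 + T x) ⁻¹' (LinearMap.range
        (T : EuclideanSpace ℝ ι →ₗ[ℝ] EuclideanSpace ℝ ι) : Set (EuclideanSpace ℝ ι)) =
        Set.univ := by
      ext x; simp [T]
    rw [this] at h0
    simp at h0
  rw [← Matrix.mulVec_surjective_iff_isUnit]
  intro y
  obtain ⟨x, hx⟩ := LinearMap.range_eq_top.1 hr (toLp 2 y)
  exact ⟨ofLp x, by simpa [T] using congrArg ofLp hx⟩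

end MultivariateGaussian

/-! ### A Pythagorean identity for the relative entropy -/

/-- With `r = dP/dF`, the inequality `r log r ≥ r - 1` bounds `r * max (-log r) 0` by `1`, which is
integrable under the finite measure `F`. -/
theorem integrable_negPart_llr {α : Type*} [MeasurableSpace α] {P F : Measure α}
    [IsFiniteMeasure P] [IsFiniteMeasure F] (h : P ≪ F) :
    Integrable (fun x => max (-llr P F x) 0) P := by
  rw [← integrable_rnDeriv_smul_iff h]
  refine (integrable_const (1 : ℝ)).mono' (by fun_prop) (ae_of_all _ fun x => ?_)
  set r := (P.rnDeriv F x).toReal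
  have hr : 0 ≤ r := ENNReal.toReal_nonneg
  have hk := klFun_nonneg hr
  rw [klFun_apply] at hk
  have hllr : llr P F x = Real.log r := rfl
  rw [hllr, smul_eq_mul, Real.norm_of_nonneg (mul_nonneg hr (le_max_right _ _)),
    mul_max_of_nonneg _ _ hr]
  exact max_le (by nlinarith) (by simp)

/-- `|A| ≤ |A + B| + A⁻ + B⁻`. This separates the terms of a log-likelihood ratio when only their
sum is known to be integrable. -/
theorem integrable_of_add_of_negPart {α : Type*} [MeasurableSpace α] {P : Measure α} {A B : α → ℝ}
    (hA : AEStronglyMeasurable A P) (hAB : Integrable (fun x => A x + B x) P)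
    (hAn : Integrable (fun x => max (-A x) 0) P) (hBn : Integrable (fun x => max (-B x) 0) P) :
    Integrable A P := by
  refine ((hAB.abs.add hAn).add hBn).mono' hA (ae_of_all _ fun x => ?_)
  simp only [Pi.add_apply, Real.norm_eq_abs]
  have h1 := le_abs_self (A x + B x)
  have h2 := le_max_left (-A x) 0
  have h3 := le_max_right (-A x) 0
  have h4 := le_max_left (-B x) 0
  have h5 := le_max_right (-B x) 0
  have h6 := abs_nonneg (A x + B x)
  exact abs_le.2 ⟨by linarith, by linarith⟩

theorem ae_rnDeriv_toReal_pos {α : Type*} [MeasurableSpace α] {P F : Measure α}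
    [IsFiniteMeasure P] [IsFiniteMeasure F] (h : P ≪ F) : ∀ᵐ x ∂P, 0 < (P.rnDeriv F x).toReal := by
  filter_upwards [Measure.rnDeriv_pos h, h.ae_le (Measure.rnDeriv_lt_top P F)] with x h0 h1
  exact ENNReal.toReal_pos h0.ne' h1.ne

/-- If `P` and `Q` have the same law of `X`, and the log-likelihood ratio of `Q` with respect to
`F` is, up to a function with the same integral under `P` and `Q`, a function of `X`, then
the divergence from `F` splits along `Q`. -/
theorem klDiv_eq_add_of_llr_eq {α β : Type*} [MeasurableSpace α] [MeasurableSpace β]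
    {P Q F : Measure α} [IsProbabilityMeasure P] [IsProbabilityMeasure Q] [IsProbabilityMeasure F]
    {X : α → β} (hXm : Measurable X) (hQF : Q ≪ F) (hPQ : P ≪ Q) (hX : P.map X = Q.map X)
    {u : β → ℝ} (hu : Measurable u) {h : α → ℝ} (hP : Integrable h P) (hQ : Integrable h Q)
    (hPQh : ∫ z, h z ∂P = ∫ z, h z ∂Q) (hllr : llr Q F =ᵐ[Q] fun z => u (X z) + h z)
    (hfin : klDiv P F ≠ ∞) : klDiv P F = klDiv P Q + klDiv Q F := by
  obtain ⟨hPF, hPi⟩ := klDiv_ne_top_iff.1 hfin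
  have htransfer {v : β → ℝ} (hv : Measurable v) :
      Integrable (fun z => v (X z)) P ↔ Integrable (fun z => v (X z)) Q := by
    have hc (R : Measure α) : Integrable v (R.map X) ↔ Integrable (fun z => v (X z)) R :=
      integrable_map_measure hv.aestronglyMeasurable hXm.aemeasurable
    rw [← hc P, ← hc Q, hX]
  -- Chain rule `dP/dF = dP/dQ · dQ/dF`, with both factors positive `P`-almost everywhere.
  have hsum : llr P F =ᵐ[P] fun z => u (X z) + (llr P Q z + h z) := by
    filter_upwards [hPF.ae_le (Measure.rnDeriv_mul_rnDeriv (κ := F) hPQ), hPQ.ae_le hllr,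
      ae_rnDeriv_toReal_pos hPQ, hPQ.ae_le (ae_rnDeriv_toReal_pos hQF)]
      with z hz hl h1 h2
    have : llr P F z = llr P Q z + llr Q F z := by
      simp only [llr]
      rw [← hz, Pi.mul_apply, ENNReal.toReal_mul, Real.log_mul h1.ne' h2.ne']
    rw [this, hl]
    ring
  -- Under `Q`, `u ∘ X` is `llr Q F - h`, whose negative part is integrable; being a function of
  -- `X`, this passes to `P`.
  have hun : Integrable (fun z => max (-u (X z)) 0) P := by
    refine (htransfer (v := fun x => max (-u x) 0) (by fun_prop)).2 ?_
    refine ((integrable_negPart_llr hQF).add hQ.abs).mono'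
      (((hu.comp hXm).neg.max measurable_const).aestronglyMeasurable) ?_
    filter_upwards [hllr] with z hz
    simp only [Pi.add_apply]
    rw [hz, Real.norm_of_nonneg (le_max_right _ _)]
    have h1 := le_abs_self (h z)
    have h2 := le_max_left (-(u (X z) + h z)) 0
    have h3 := le_max_right (-(u (X z) + h z)) 0
    exact max_le (by linarith) (add_nonneg h3 (abs_nonneg _))
  have hAB : Integrable (fun z => u (X z) + llr P Q z) P := by
    refine (hPi.sub hP).congr ?_
    filter_upwards [hsum] with z hz
    simp only [Pi.sub_apply, hz]
    ring
  -- Finiteness of `klDiv P F` controls only the sum; the two negative parts then make each summand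
  -- integrable, and both divergences on the right are finite.
  have huP : Integrable (fun z => u (X z)) P :=
    integrable_of_add_of_negPart (hu.comp hXm).aestronglyMeasurable hAB hun (integrable_negPart_llr hPQ)
  have hPQi : Integrable (llr P Q) P := by
    refine (hAB.sub huP).congr (ae_of_all _ fun z => ?_)
    simp
  have huQ : Integrable (fun z => u (X z)) Q := (htransfer hu).1 huP
  have hQi : Integrable (llr Q F) Q := (huQ.add hQ).congr hllr.symm
  have huPQ : ∫ z, u (X z) ∂P = ∫ z, u (X z) ∂Q := by
    rw [← integral_map hXm.aemeasurable hu.aestronglyMeasurable, hX,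
      integral_map hXm.aemeasurable hu.aestronglyMeasurable]
  have h1 : klDiv P Q ≠ ∞ := klDiv_ne_top_iff.2 ⟨hPQ, hPQi⟩
  have h2 : klDiv Q F ≠ ∞ := klDiv_ne_top_iff.2 ⟨hQF, hQi⟩
  rw [← ENNReal.toReal_eq_toReal_iff' hfin (ENNReal.add_ne_top.2 ⟨h1, h2⟩),
    ENNReal.toReal_add h1 h2, toReal_klDiv_of_measure_eq hPF (by simp),
    toReal_klDiv_of_measure_eq hPQ (by simp), toReal_klDiv_of_measure_eq hQF (by simp),
    integral_congr_ae hsum, integral_congr_ae hllr, integral_add huP (by exact hPQi.add hP),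
    integral_add hPQi hP, integral_add huQ hQ, huPQ, hPQh]
  ring

/-! ### Shears of a product -/

section Shear

variable {E F : Type*} [NormedAddCommGroup E] [InnerProductSpace ℝ E]
  [MeasurableSpace E] [BorelSpace E] [NormedAddCommGroup F] [InnerProductSpace ℝ F]
  [FiniteDimensional ℝ F] [MeasurableSpace F] [BorelSpace F]

/-- The shear `(x, w) ↦ (x, α + B x + w)`. -/
def shearEquiv (α : F) (B : E →L[ℝ] F) : E × F ≃ᵐ E × F where
  toFun z := (z.1, α + B z.1 + z.2)
  invFun z := (z.1, z.2 - (α + B z.1))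
  left_inv z := by simp
  right_inv z := by simp
  measurable_toFun := by
    change Measurable fun z : E × F => (z.1, α + B z.1 + z.2)
    fun_prop
  measurable_invFun := by
    change Measurable fun z : E × F => (z.1, z.2 - (α + B z.1))
    fun_prop

theorem shearEquiv_apply (α : F) (B : E →L[ℝ] F) (z : E × F) :
    shearEquiv α B z = (z.1, α + B z.1 + z.2) := rfl

theorem shearEquiv_symm_apply (α : F) (B : E →L[ℝ] F) (z : E × F) :
    (shearEquiv α B).symm z = (z.1, z.2 - (α + B z.1)) := rfl

variable [FiniteDimensional ℝ E]

theorem measurePreserving_shearEquiv (α : F) (B : E →L[ℝ] F) :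
    MeasurePreserving (shearEquiv α B) :=
  (MeasurePreserving.id volume).skew_product (μc := volume) (μd := volume)
    (g := fun x w => α + B x + w) (by simp only [Function.uncurry_def]; fun_prop)
    (ae_of_all _ fun x => (measurePreserving_add_left volume (α + B x)).map_eq)

/-- A shear translates each fibre, so it preserves volume and no Jacobian factor appears. -/
theorem densityMeasure_shear {g : E → ℝ} (hg : IsProbDensity g) {φ : F → ℝ}
    (hφ : Measurable φ) (α : F) (B : E →L[ℝ] F) :
    densityMeasure (fun z : E × F => g z.1 * φ (z.2 - (α + B z.1))) =
      ((densityMeasure g).prod (densityMeasure φ)).map (shearEquiv α B) := by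
  rw [densityMeasure, densityMeasure, densityMeasure,
    prod_withDensity hg.measurable.ennreal_ofReal hφ.ennreal_ofReal,
    MeasurableEquiv.map_withDensity, ← Measure.volume_eq_prod,
    (measurePreserving_shearEquiv α B).map_eq]
  congr 1
  ext z
  simp [shearEquiv_symm_apply, ENNReal.ofReal_mul (hg.nonneg _)]

/-- Undo the volume-preserving shear and test on strips `univ ×ˢ s`. Applied to the prior, it shows
that the residual Gaussian is nondegenerate. -/
theorem ac_volume_of_map_shear_ac {μ : Measure E} {ν : Measure F} [IsProbabilityMeasure μ]
    [IsProbabilityMeasure ν] {α : F} {B : E →L[ℝ] F}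
    (h : (μ.prod ν).map (shearEquiv α B) ≪ volume) : ν ≪ volume := by
  have h' : μ.prod ν ≪ volume := by
    have := h.map (shearEquiv α B).symm.measurable
    rwa [MeasurableEquiv.map_symm_map,
      (measurePreserving_shearEquiv α B).symm.map_eq] at this
  refine Measure.AbsolutelyContinuous.mk fun s _ hs => ?_
  have h0 := h' (s := Set.univ ×ˢ s) 
    (by rw [Measure.volume_eq_prod, Measure.prod_prod, hs, mul_zero])
  rwa [Measure.prod_prod, measure_univ, one_mul] at h0

end Shear

/-! ### Gaussian regression -/

section MultivariateGaussian

open scoped MatrixOrder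

theorem Matrix.PosDef.isUnit_sqrt {ι : Type*} [Fintype ι] [DecidableEq ι] {S : Matrix ι ι ℝ}
    (hS : S.PosDef) : IsUnit (CFC.sqrt S) := by
  have h := hS.isUnit
  rw [← CFC.sqrt_mul_sqrt_self S hS.posSemidef.nonneg] at h
  exact isUnit_of_mul_isUnit_left h

end MultivariateGaussian

/-- The regression of `Y` on `X` in a jointly Gaussian pair `(X, Y)`. -/
theorem gaussianPairLaw_eq_map_shear {n k : ℕ}
    (μx : EuclideanSpace ℝ (Fin n)) (μy : EuclideanSpace ℝ (Fin k))
    {Sxx : Matrix (Fin n) (Fin n) ℝ} {Sxy : Matrix (Fin n) (Fin k) ℝ}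
    {Syx : Matrix (Fin k) (Fin n) ℝ} {Syy : Matrix (Fin k) (Fin k) ℝ}
    (hS : (Matrix.fromBlocks Sxx Sxy Syx Syy).PosSemidef) (hSxx : Sxx.PosDef)
    {B : EuclideanSpace ℝ (Fin n) →L[ℝ] EuclideanSpace ℝ (Fin k)}
    (hB : ∀ x, B x = toLp 2 ((Syx * Sxx⁻¹) *ᵥ ofLp x)) :
    gaussianPairLaw μx μy Sxx Sxy Syx Syy =
      ((multivariateGaussian μx Sxx).prod
        (multivariateGaussian 0 (Syy - Syx * Sxx⁻¹ * Sxy))).map (shearEquiv (μy - B μx) B) := by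
  have hinv : Invertible Sxx := hSxx.isUnit.invertible
  obtain rfl : Sxyᴴ = Syx := (isHermitian_fromBlocks_iff.1 hS.1).2.1
  have hC : (Syy - Sxyᴴ * Sxx⁻¹ * Sxy).PosSemidef := (PosDef.fromBlocks₁₁ Sxy Syy hSxx).1 hS
  set C := Syy - Sxyᴴ * Sxx⁻¹ * Sxy
  set ρ := (multivariateGaussian μx Sxx).prod (multivariateGaussian 0 C)
  set G : EuclideanSpace ℝ (Fin n) × EuclideanSpace ℝ (Fin k) →
    EuclideanSpace ℝ (Fin n ⊕ Fin k) := fun z => toLp 2 (Sum.elim (ofLp z.1) (ofLp z.2))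
  have hG : Measurable G := by
    refine (measurable_toLp 2 _).comp (measurable_pi_iff.2 ?_)
    rintro (i | i) <;> simp only [Sum.elim_inl, Sum.elim_inr] <;> fun_prop
  have key : multivariateGaussian (toLp 2 (Sum.elim (ofLp μx) (ofLp μy)))
      (Matrix.fromBlocks Sxx Sxy Sxyᴴ Syy) =
      ρ.map (fun z => G (shearEquiv (μy - B μx) B z)) := by
    have hm : Measurable (fun z => G (shearEquiv (μy - B μx) B z)) :=
      hG.comp (shearEquiv _ B).measurable
    have := Measure.isProbabilityMeasure_map (μ := ρ) hm.aemeasurable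
    refine Measure.ext_of_charFun ?_
    ext t
    rw [charFun_multivariateGaussian hS, charFun_apply,
      integral_map hm.aemeasurable (by fun_prop)]
    set s : EuclideanSpace ℝ (Fin n) := toLp 2 fun i => t (Sum.inl i)
    set r : EuclideanSpace ℝ (Fin k) := toLp 2 fun j => t (Sum.inr j)
    -- `v = s + Bᵀ r` collects what pairs with `x` in the sheared vector; it is also the vector that
    -- completes the square in the Schur complement formula.
    set v : EuclideanSpace ℝ (Fin n) := toLp 2 (ofLp s + (Sxx⁻¹ * Sxy) *ᵥ ofLp r)
    have ht : ofLp t = Sum.elim (ofLp s) (ofLp r) := by ext (i | i) <;> rfl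
    have hBv (x) : inner ℝ x s + inner ℝ (B x) r = inner ℝ x v := by
      rw [hB]
      simp only [EuclideanSpace.inner_eq_star_dotProduct, v, star_trivial, add_dotProduct]
      congr 1
      rw [dotProduct_mulVec, ← mulVec_transpose]
      congr 2
      rw [transpose_mul, transpose_nonsing_inv, conjTranspose_eq_transpose_of_trivial,
        transpose_transpose, ← conjTranspose_eq_transpose_of_trivial Sxx, hSxx.1.eq]
    have hinner (x w) : inner ℝ (G (shearEquiv (μy - B μx) B (x, w))) t =
        (inner ℝ μy r - inner ℝ (B μx) r) + inner ℝ x v + inner ℝ w r := by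
      have : inner ℝ (G (shearEquiv (μy - B μx) B (x, w))) t =
          inner ℝ x s + inner ℝ ((μy - B μx) + B x + w) r := by
        simp [EuclideanSpace.inner_eq_star_dotProduct, G, ht, shearEquiv_apply]
      rw [this, ← hBv, inner_add_left, inner_add_left, inner_sub_left]
      ring
    have hint : ∫ z, Complex.exp (inner ℝ (G (shearEquiv (μy - B μx) B z)) t * Complex.I) ∂ρ =
        Complex.exp ((inner ℝ μy r - inner ℝ (B μx) r : ℝ) * Complex.I) *
          (charFun (multivariateGaussian μx Sxx) v * charFun (multivariateGaussian 0 C) r) := by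
      rw [charFun_apply, charFun_apply, ← integral_prod_mul, ← integral_const_mul]
      congr 1
      ext ⟨x, w⟩
      rw [hinner, ← Complex.exp_add, ← Complex.exp_add]
      congr 1
      push_cast
      ring
    rw [hint, charFun_multivariateGaussian hSxx.posSemidef, charFun_multivariateGaussian hC,
      ← Complex.exp_add, ← Complex.exp_add, ht]
    have hq := schur_complement_eq₁₁ Sxy Syy (ofLp s) (ofLp r) hSxx.1
    simp only [star_trivial] at hq
    rw [dotProduct_mulVec, hq, ← dotProduct_mulVec, ← dotProduct_mulVec]
    have hmean : inner ℝ t (toLp 2 (Sum.elim (ofLp μx) (ofLp μy))) =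
        inner ℝ v μx + (inner ℝ μy r - inner ℝ (B μx) r) := by
      rw [real_inner_comm μx v, ← hBv]
      simp [EuclideanSpace.inner_eq_star_dotProduct, ht, dotProduct_comm]
    rw [hmean]
    congr 1
    simp only [v, inner_zero_right]
    push_cast
    ring
  have hm : Measurable (fun z => G (shearEquiv (μy - B μx) B z)) :=
    hG.comp (shearEquiv _ B).measurable
  rw [gaussianPairLaw, key, Measure.map_map (by fun_prop) hm]
  rfl

/-! ### Feasible densities -/

theorem map_fst_densityMeasure {α β : Type*} [MeasureSpace α] [MeasureSpace β]
    [SFinite (volume : Measure α)] [SFinite (volume : Measure β)] {p : α × β → ℝ} (hp : Measurable p) {g : α → ℝ}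
    (h : ∀ x, ∫⁻ y, ENNReal.ofReal (p (x, y)) = ENNReal.ofReal (g x)) :
    (densityMeasure p).map Prod.fst = densityMeasure g := by
  ext s hs
  rw [Measure.map_apply measurable_fst hs, densityMeasure, densityMeasure,
    withDensity_apply _ (measurable_fst hs), withDensity_apply _ hs, ← Set.prod_univ,
    Measure.volume_eq_prod, setLIntegral_prod _ hp.ennreal_ofReal.aemeasurable]
  simp [h]

section Feasible

variable {n k : ℕ} {f : EuclideanSpace ℝ (Fin n) × EuclideanSpace ℝ (Fin k) → ℝ}
  {g : EuclideanSpace ℝ (Fin n) → ℝ} {a : EuclideanSpace ℝ (Fin k)}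
  {p : EuclideanSpace ℝ (Fin n) × EuclideanSpace ℝ (Fin k) → ℝ}

theorem IsFeasible.map_fst (hp : IsFeasible f g a p) :
    (densityMeasure p).map Prod.fst = densityMeasure g :=
  map_fst_densityMeasure hp.isProbDensity.measurable hp.marginal

theorem IsFeasible.integrable_snd (hp : IsFeasible f g a p) :
    Integrable Prod.snd (densityMeasure p) :=
  (integrable_densityMeasure_iff hp.isProbDensity).2 hp.integrable

theorem IsFeasible.integral_snd (hp : IsFeasible f g a p) :
    ∫ z, z.2 ∂densityMeasure p = a := by
  rw [integral_densityMeasure hp.isProbDensity, hp.mean]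

theorem IsFeasible.integrable_fst (hp : IsFeasible f g a p)
    (hg : Integrable id (densityMeasure g)) : Integrable Prod.fst (densityMeasure p) := by
  rw [← hp.map_fst] at hg
  exact hg.comp_measurable measurable_fst

theorem IsFeasible.integral_fst (hp : IsFeasible f g a p) :
    ∫ z, z.1 ∂densityMeasure p = ∫ x, x ∂densityMeasure g := by
  rw [← hp.map_fst, integral_map measurable_fst.aemeasurable (by fun_prop)]

/-- A feasible density is absolutely continuous with respect to any density `g x * r (x, y)`
with `r` positive. -/
theorem IsFeasible.absolutelyContinuous_mul (hp : IsFeasible f g a p) (hg : IsProbDensity g)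
    {r : EuclideanSpace ℝ (Fin n) × EuclideanSpace ℝ (Fin k) → ℝ} (hr : Measurable r)
    (hr0 : ∀ z, 0 < r z) :
    densityMeasure p ≪ densityMeasure fun z => g z.1 * r z := by
  refine Measure.AbsolutelyContinuous.mk fun s _ hs => ?_
  have hgm := hg.measurable
  rw [densityMeasure, withDensity_apply_eq_zero (by fun_prop)] at hs
  have hset : {z : EuclideanSpace ℝ (Fin n) × EuclideanSpace ℝ (Fin k) |
      ENNReal.ofReal (g z.1 * r z) ≠ 0} = {z | g z.1 ≠ 0} := by
    ext z
    simp [mul_pos_iff_of_pos_right (hr0 z), (hg.nonneg z.1).lt_iff_ne, eq_comm]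
  rw [hset] at hs
  have h1 := withDensity_absolutelyContinuous volume (fun z => ENNReal.ofReal (p z)) hs
  -- Where `g` vanishes the marginal of `p` has no mass, so only the set `g ≠ 0` matters.
  have h2 : densityMeasure p {z | ¬ g z.1 ≠ 0} = 0 := by
    have hm : MeasurableSet {x | ¬ g x ≠ 0} := by measurability
    change densityMeasure p (Prod.fst ⁻¹' {x | ¬ g x ≠ 0}) = 0
    rw [← Measure.map_apply measurable_fst hm, hp.map_fst, densityMeasure,
      withDensity_apply_eq_zero hgm.ennreal_ofReal]
    convert! measure_empty (μ := volume)
    ext x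
    simp only [Set.mem_inter_iff, Set.mem_ofPred_eq, Set.mem_empty_iff_false, iff_false, not_and,
      not_not]
    intro hx h0
    simp [h0] at hx
  refine measure_mono_null (fun z hz => ?_) (measure_union_null h1 h2)
  by_cases h : g z.1 ≠ 0
  · exact Or.inl ⟨h, hz⟩
  · exact Or.inr h

/-- The density `g x * φ (y - (α + B x))` of `(X, α + B X + W)`, with `X` of density `g` and
`W` independent, centered and of density `φ`, is feasible when `α + B E[X] = a`. -/
theorem isFeasible_shear (hf : volume ≪ densityMeasure f) (hg : IsProbDensity g)
    (hgi : Integrable id (densityMeasure g)) {φ : EuclideanSpace ℝ (Fin k) → ℝ}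
    (hφ : IsProbDensity φ) (hφi : Integrable id (densityMeasure φ))
    (hφ0 : ∫ y, y ∂densityMeasure φ = 0) {α : EuclideanSpace ℝ (Fin k)}
    {B : EuclideanSpace ℝ (Fin n) →L[ℝ] EuclideanSpace ℝ (Fin k)}
    (ha : α + B (∫ x, x ∂densityMeasure g) = a) :
    IsFeasible f g a fun z => g z.1 * φ (z.2 - (α + B z.1)) := by
  have := hg.isProbabilityMeasure
  have := hφ.isProbabilityMeasure
  have hgm := hg.measurable
  have hφm := hφ.measurable
  have hQ := densityMeasure_shear hg hφm α B
  set Q := ((densityMeasure g).prod (densityMeasure φ)).map (shearEquiv α B)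
  have hQp : IsProbabilityMeasure Q :=
    Measure.isProbabilityMeasure_map (shearEquiv α B).measurable.aemeasurable
  have hq := (isDensityOf_of_densityMeasure_eq (by fun_prop)
    (fun z => mul_nonneg (hg.nonneg _) (hφ.nonneg _)) hQ).isProbDensity
  have h1 : Integrable (fun z : EuclideanSpace ℝ (Fin n) × EuclideanSpace ℝ (Fin k) => α + B z.1)
      ((densityMeasure g).prod (densityMeasure φ)) :=
    (integrable_const α).add (B.integrable_comp (hgi.comp_fst _))
  have h2 : Integrable (fun z : EuclideanSpace ℝ (Fin n) × EuclideanSpace ℝ (Fin k) => z.2)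
      ((densityMeasure g).prod (densityMeasure φ)) := hφi.comp_snd _
  refine ⟨hq, (withDensity_absolutelyContinuous _ _).trans hf, fun x => ?_, ?_, ?_⟩
  · simp_rw [ENNReal.ofReal_mul (hg.nonneg x)]
    rw [lintegral_const_mul _ (by fun_prop),
      lintegral_sub_right_eq_self (fun y => ENNReal.ofReal (φ y)), hφ.lintegral_eq_one, mul_one]
  · rw [← integrable_densityMeasure_iff hq, hQ, integrable_map_equiv]
    exact h1.add h2
  · rw [← integral_densityMeasure hq, hQ, integral_map_equiv]
    simp only [shearEquiv_apply]
    rw [integral_add h1 h2, integral_fun_fst (f := fun x => α + B x),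
      integral_fun_snd (f := fun y => y), hφ0]
    have h3 : ∫ x, (α + B x) ∂densityMeasure g = a := by
      rw [integral_add (integrable_const α) (by exact B.integrable_comp hgi),
        ← ha, ← B.integral_comp_comm (φ := fun x => x) hgi]
      simp
    simp [h3]

/-- The divergence of any feasible density from `f0 x * φ (y - (β + B x))` splits along
the feasible density `g x * φ (y - (α + B x))`, provided that the logarithm of `φ` changes by an
affine function under translations. -/
theorem IsFeasible.klDiv_eq_add (hp : IsFeasible f g a p) (hg : IsProbDensity g)
    (hgi : Integrable id (densityMeasure g)) {φ : EuclideanSpace ℝ (Fin k) → ℝ}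
    (hφm : Measurable φ) (hφ0 : ∀ y, 0 < φ y)
    (hφ : ∀ α β, ∃ (L : EuclideanSpace ℝ (Fin k) →L[ℝ] ℝ) (c : ℝ), ∀ u,
      Real.log (φ (u - α)) - Real.log (φ (u - β)) = L u + c)
    {f0 : EuclideanSpace ℝ (Fin n) → ℝ} (hf0m : Measurable f0) (hf0 : ∀ x, 0 < f0 x)
    {α β : EuclideanSpace ℝ (Fin k)}
    {B : EuclideanSpace ℝ (Fin n) →L[ℝ] EuclideanSpace ℝ (Fin k)}
    (hfeas : IsFeasible f g a fun z => g z.1 * φ (z.2 - (α + B z.1)))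
    (hf : IsProbDensity f)
    (hfeq : densityMeasure f = densityMeasure fun z => f0 z.1 * φ (z.2 - (β + B z.1)))
    (hfin : iDivergence p f ≠ ∞) :
    iDivergence p f = iDivergence p (fun z => g z.1 * φ (z.2 - (α + B z.1))) +
      iDivergence (fun z => g z.1 * φ (z.2 - (α + B z.1))) f := by
  obtain ⟨L, c, hLc⟩ := hφ α β
  have hgm := hg.measurable
  have := hp.isProbDensity.isProbabilityMeasure
  have := hfeas.isProbDensity.isProbabilityMeasure
  have := hf.isProbabilityMeasure
  set q : EuclideanSpace ℝ (Fin n) × EuclideanSpace ℝ (Fin k) → ℝ :=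
    fun z => g z.1 * φ (z.2 - (α + B z.1))
  -- The affine part of the log-ratio; its integral sees only the two prescribed means.
  set h : EuclideanSpace ℝ (Fin n) × EuclideanSpace ℝ (Fin k) → ℝ :=
    fun z => (L z.2 - (L.comp B) z.1) + c
  have hint {p'} (hp' : IsFeasible f g a p') : Integrable h (densityMeasure p') ∧
      ∫ z, h z ∂densityMeasure p' =
        L a - (L.comp B) (∫ x, x ∂densityMeasure g) + c := by
    have := hp'.isProbDensity.isProbabilityMeasure
    have h1 := L.integrable_comp hp'.integrable_snd
    have h2 := (L.comp B).integrable_comp (hp'.integrable_fst hgi)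
    refine ⟨(h1.sub h2).add (integrable_const c), ?_⟩
    have e1 : ∫ z, h z ∂densityMeasure p' =
        ∫ z, (L z.2 - (L.comp B) z.1) ∂densityMeasure p' + c := by
      rw [integral_add (by exact h1.sub h2) (integrable_const c)]
      simp
    rw [e1, integral_sub h1 h2, L.integral_comp_comm hp'.integrable_snd,
      (L.comp B).integral_comp_comm (hp'.integrable_fst hgi), hp'.integral_snd, hp'.integral_fst]
  have hdens : densityMeasure q = (densityMeasure f).withDensity
      fun z => ENNReal.ofReal (q z / (f0 z.1 * φ (z.2 - (β + B z.1)))) := by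
    rw [hfeq, densityMeasure, densityMeasure, ← withDensity_mul _ (by fun_prop) (by fun_prop)]
    congr 1
    ext z
    have hpos := mul_pos (hf0 z.1) (hφ0 (z.2 - (β + B z.1)))
    rw [Pi.mul_apply, ← ENNReal.ofReal_mul hpos.le, mul_div_cancel₀ _ hpos.ne']
  have hqpos : ∀ᵐ z ∂densityMeasure q, 0 < q z := by
    rw [densityMeasure, ae_withDensity_iff (by fun_prop)]
    exact ae_of_all _ fun z hz => by simpa using hz
  refine klDiv_eq_add_of_llr_eq (X := Prod.fst) (u := fun x => Real.log (g x) - Real.log (f0 x))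
    (h := h) measurable_fst hfeas.absolutelyContinuous
    (hp.absolutelyContinuous_mul hg (by fun_prop) fun z => hφ0 _)
    (hp.map_fst.trans hfeas.map_fst.symm) (by fun_prop) (hint hp).1 (hint hfeas).1
    ((hint hp).2.trans (hint hfeas).2.symm) ?_ hfin
  have hrn : (densityMeasure q).rnDeriv (densityMeasure f) =ᵐ[densityMeasure f]
      fun z => ENNReal.ofReal (q z / (f0 z.1 * φ (z.2 - (β + B z.1)))) := by
    conv_lhs => rw [hdens]
    exact Measure.rnDeriv_withDensity _ (by fun_prop)
  filter_upwards [hqpos, hfeas.absolutelyContinuous.ae_le hrn] with z hz hr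
  have hgz : 0 < g z.1 := (pos_iff_pos_of_mul_pos hz).2 (hφ0 _)
  have hpos := mul_pos (hf0 z.1) (hφ0 (z.2 - (β + B z.1)))
  rw [llr, hr, ENNReal.toReal_ofReal (by positivity), Real.log_div hz.ne' hpos.ne',
    Real.log_mul hgz.ne' (hφ0 _).ne', Real.log_mul (hf0 _).ne' (hφ0 _).ne']
  -- The translation property is used at the residual `y - Bx`.
  have := hLc (z.2 - B z.1)
  rw [map_sub, sub_sub, sub_sub, add_comm (B z.1), add_comm (B z.1)] at this
  simp only [h, ContinuousLinearMap.comp_apply]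
  linarith

end Feasible

/-! ### The minimizer and its uniqueness -/

theorem mainTheorem8 {n k : ℕ}
    (μx : EuclideanSpace ℝ (Fin n)) (μy : EuclideanSpace ℝ (Fin k))
    (Sxx : Matrix (Fin n) (Fin n) ℝ) (Sxy : Matrix (Fin n) (Fin k) ℝ)
    (Syx : Matrix (Fin k) (Fin n) ℝ) (Syy : Matrix (Fin k) (Fin k) ℝ)
    (hS : (Matrix.fromBlocks Sxx Sxy Syx Syy).PosSemidef)
    (hSxx : IsUnit Sxx)
    (f : EuclideanSpace ℝ (Fin n) × EuclideanSpace ℝ (Fin k) → ℝ)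
    (hf : IsDensityOf f (gaussianPairLaw μx μy Sxx Sxy Syx Syy))
    (g : EuclideanSpace ℝ (Fin n) → ℝ) (hg : IsProbDensity g)
    (hg1 : ∀ i, Integrable fun x : EuclideanSpace ℝ (Fin n) => g x * x i)
    (a : EuclideanSpace ℝ (Fin k)) :
    ∃ q : EuclideanSpace ℝ (Fin n) → EuclideanSpace ℝ (Fin k) → ℝ,
      (∀ x, IsDensityOf (q x)
        (multivariateGaussian
          (a + toLp 2 ((Syx * Sxx⁻¹) *ᵥ ofLp (x - ∫ x', g x' • x')))
          (Syy - Syx * Sxx⁻¹ * Sxy))) ∧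
      IsOptimal f g a (fun z => g z.1 * q z.1 z.2) ∧
      (iDivergence (fun z => g z.1 * q z.1 z.2) f ≠ ∞ →
        ∀ p, IsOptimal f g a p → p =ᵐ[volume] fun z => g z.1 * q z.1 z.2) := by
  have hSxx' : Sxx.PosDef := by
    have : Sxx.PosSemidef := hS.submatrix Sum.inl
    exact this.posDef_iff_isUnit.2 hSxx
  set C := Syy - Syx * Sxx⁻¹ * Sxy
  set B : EuclideanSpace ℝ (Fin n) →L[ℝ] EuclideanSpace ℝ (Fin k) :=
    (Matrix.toEuclideanLin (Syx * Sxx⁻¹)).toContinuousLinearMap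
  have hB : ∀ x, B x = toLp 2 ((Syx * Sxx⁻¹) *ᵥ ofLp x) := fun x => rfl
  have hlaw := gaussianPairLaw_eq_map_shear μx μy hS hSxx' hB
  set β := μy - B μx
  have hlaw_ac : gaussianPairLaw μx μy Sxx Sxy Syx Syy ≪ volume := by
    rw [← hf.densityMeasure_eq]
    exact withDensity_absolutelyContinuous _ _
  have hC := isUnit_sqrt_of_multivariateGaussian_ac (ac_volume_of_map_shear_ac (hlaw ▸ hlaw_ac))
  obtain ⟨φ, hφc, hφ0, hφd, hφL⟩ := exists_multivariateGaussian_density hC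
  obtain ⟨ψ, hψc, hψ0, hψd, -⟩ := exists_multivariateGaussian_density hSxx'.isUnit_sqrt
  have hφ := hφd 0
  simp only [sub_zero] at hφ
  have hψ := hψd μx
  have hfeq : densityMeasure f =
      densityMeasure fun z => ψ (z.1 - μx) * φ (z.2 - (β + B z.1)) := by
    rw [hf.densityMeasure_eq, hlaw, densityMeasure_shear hψ.isProbDensity hφc.measurable β B,
      hψ.densityMeasure_eq, hφ.densityMeasure_eq]
  -- The prior is equivalent to Lebesgue measure, so absolute continuity of the candidate is
  -- automatic.
  have hvol : volume ≪ densityMeasure f := by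
    rw [hfeq]
    refine withDensity_absolutelyContinuous' (by fun_prop) (ae_of_all _ fun z => ?_)
    exact (ENNReal.ofReal_pos.2 (mul_pos (hψ0 _) (hφ0 _))).ne'
  have hgi : Integrable id (densityMeasure g) := by
    rw [integrable_densityMeasure_iff hg, integrable_piLp_iff]
    exact hg1
  have hm : ∫ x', g x' • x' = ∫ x, x ∂densityMeasure g := (integral_densityMeasure hg _).symm
  rw [hm]
  set m := ∫ x, x ∂densityMeasure g
  set α := a - B m
  have hmean (x) : a + toLp 2 ((Syx * Sxx⁻¹) *ᵥ ofLp (x - m)) = α + B x := by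
    rw [← hB, map_sub]
    simp only [α]
    abel
  simp only [hmean]
  have hfeas : IsFeasible f g a fun z => g z.1 * φ (z.2 - (α + B z.1)) := by
    refine isFeasible_shear hvol hg hgi hφ.isProbDensity ?_ ?_ (by simp [α, m])
    · rw [hφ.densityMeasure_eq]
      exact IsGaussian.integrable_id
    · rw [hφ.densityMeasure_eq]
      exact integral_id_multivariateGaussian
  have hpyth {p} (hp : IsFeasible f g a p) (hfin : iDivergence p f ≠ ∞) :=
    hp.klDiv_eq_add hg hgi hφc.measurable hφ0 hφL (f0 := fun x => ψ (x - μx)) (by fun_prop)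
      (fun x => hψ0 _) hfeas hf.isProbDensity hfeq hfin
  have hopt : IsOptimal f g a fun z => g z.1 * φ (z.2 - (α + B z.1)) := by
    refine ⟨hfeas, fun p hp => ?_⟩
    by_cases hfin : iDivergence p f = ∞
    · rw [hfin]
      exact le_top
    · rw [hpyth hp hfin]
      exact le_add_self
  refine ⟨fun x y => φ (y - (α + B x)), fun x => hφd _, hopt, fun hfin p hp => ?_⟩
  have heq := le_antisymm (hp.le _ hfeas) (hopt.le _ hp.isFeasible)
  have hsplit := hpyth hp.isFeasible (heq ▸ hfin)
  rw [heq] at hsplit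
  -- Both optimal values agree and are finite, so they cancel in the Pythagorean identity.
  have hzero : iDivergence p (fun z => g z.1 * φ (z.2 - (α + B z.1))) = 0 :=
    (ENNReal.add_left_inj hfin).1 (by rw [zero_add, ← hsplit])
  have := hp.isFeasible.isProbDensity.isProbabilityMeasure
  have := hfeas.isProbDensity.isProbabilityMeasure
  exact (densityMeasure_eq_iff hp.isFeasible.isProbDensity hfeas.isProbDensity).1
    (klDiv_eq_zero_iff.1 hzero)
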